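/- Graphs are finite, simple and nonempty, except that $K_0$ denotes the null graph; $K_1$ and $K_2$ are regarded as Hamiltonian. Write $G\ast H$ for the join (the disjoint union $G\sqcup H$ together with all edges between $V(G)$ and $V(H)$), so $K_0\ast G=G$. Let $$\check\mu(G)=\min\{\,l\ge 0 : K_l\ast G \text{ is Hamiltonian}\,\},$$ and let $i_H(G)=1$ if $G$ is Hamiltonian and $i_H(G)=0$ otherwise. A vertex is universal if it is adjacent to every other vertex. For $t\ge 0$ let $\mathscr M_t$ be the class of graphs $G$ with $\check\mu(G)=t$ and $\check\mu(G+e)<t$ for every edge $e$ of the complement $\overline G$; let $\mathscr N_t$ be the class of connected graphs in $\mathscr M_t$ that have no universal vertex. **Theorem.** Let $t>0$ and $G\in\mathscr M_t$. Then $G$ can be written as $$G\cong K_s\ast(G_1\sqcup\dots\sqcup G_r),$$ where $s$ is the number of universal vertices of $G$ and each $G_j$ is either complete or belongs to $\mathscr N_{t_j}$ for some $t_j>0$. With $t_j:=\check\mu(G_j)$ for all $j$ (so $t_j=0$ when $G_j$ is complete), $$t=\sum_{j=1}^r t_j+\sum_{j=1}^r i_H(G_j)-s .$$ The decomposition is unique: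 if also $G\cong K_{s'}\ast(G'_1\sqcup\dots\sqcup G'_{r'})$ with each $G'_j$ either complete or in $\mathscr N_{t'_j}$ for some $t'_j>0$, then $s'=s$, $r'=r$, and there are a permutation $\sigma$ of $\{1,\dots,r\}$ and isomorphisms $G_j\cong G'_{\sigma(j)}$ that respect the given identifications with $G$ (so $G_j$ and $G'_{\sigma(j)}$ occupy the same vertices of $G$). -/

import Mathlib

universe u v

namespace SimpleGraph

/-- The join `G ∗ H`: the disjoint union of `G` and `H` together with all edges between a vertex
of `G` and a vertex of `H`. -/
def graphJoin {V : Type u} {W : Type v} (G : SimpleGraph V) (H : SimpleGraph W) :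
    SimpleGraph (V ⊕ W) :=
  (G ⊕g H) ⊔ completeBipartiteGraph V W

/-- The disjoint union of a family of graphs. -/
def disjUnion {ι : Type u} {W : ι → Type v} (H : ∀ j, SimpleGraph (W j)) :
    SimpleGraph (Σ j, W j) where
  Adj x y := ∃ (j : ι) (a b : W j), (H j).Adj a b ∧ x = ⟨j, a⟩ ∧ y = ⟨j, b⟩
  symm.symm _ _ := fun ⟨j, a, b, h, hx, hy⟩ => ⟨j, b, a, h.symm, hy, hx⟩
  loopless.irrefl := by
    rintro x ⟨j, a, b, h, rfl, hy⟩
    obtain rfl : a = b := by simpa using hy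
    exact h.ne rfl

open Classical in
/-- Hamiltonicity, with the convention that the complete graphs `K₁` and `K₂` are Hamiltonian.
(Mathlib's `IsHamiltonian` already includes `K₁`.) -/
def IsHam {V : Type u} [Fintype V] (G : SimpleGraph V) : Prop :=
  G.IsHamiltonian ∨ (Fintype.card V = 2 ∧ G = ⊤)

/-- The invariant `μ̌(G)`: the least `l ≥ 0` such that `K_l ∗ G` is Hamiltonian. -/
noncomputable def muCheck {V : Type u} [Fintype V] (G : SimpleGraph V) : ℕ :=
  sInf {l : ℕ | (graphJoin (⊤ : SimpleGraph (Fin l)) G).IsHam}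

open Classical in
/-- `i_H(G)` is `1` if `G` is Hamiltonian and `0` otherwise. -/
noncomputable def hamIndicator {V : Type u} [Fintype V] (G : SimpleGraph V) : ℕ :=
  if G.IsHam then 1 else 0

/-- Membership in `𝓜_t`: `μ̌(G) = t`, and `μ̌(G + e) < t` for each edge `e` of the complement. -/
def IsMaximalTraceable {V : Type u} [Fintype V] (t : ℕ) (G : SimpleGraph V) : Prop :=
  G.muCheck = t ∧ ∀ x y : V, Gᶜ.Adj x y → (G ⊔ edge x y).muCheck < t

/-- Membership in `𝓝_t`: graphs in `𝓜_t` that are connected and have no universal vertex. -/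
def IsTrim {V : Type u} [Fintype V] (t : ℕ) (G : SimpleGraph V) : Prop :=
  IsMaximalTraceable t G ∧ G.Connected ∧ ∀ x : V, ¬ G.IsUniversal x

/-- A way of writing `G` as `K_s ∗ (G_1 ⊔ … ⊔ G_r)` with finite nonempty graphs `G_j`. -/
structure JoinDecomposition {V : Type u} (G : SimpleGraph V) where
  s : ℕ
  r : ℕ
  W : Fin r → Type v
  [fintypeW : ∀ j, Fintype (W j)]
  [nonemptyW : ∀ j, Nonempty (W j)]
  part : ∀ j, SimpleGraph (W j)
  iso : graphJoin (⊤ : SimpleGraph (Fin s)) (disjUnion part) ≃g G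

attribute [instance] JoinDecomposition.fintypeW JoinDecomposition.nonemptyW

/-- Each part is complete, or trim in some `𝓝_{t_j}` with `t_j > 0`. -/
def JoinDecomposition.IsCompleteOrTrim {V : Type u} {G : SimpleGraph V}
    (D : JoinDecomposition.{u, v} G) : Prop :=
  ∀ j, D.part j = ⊤ ∨ ∃ tj : ℕ, 0 < tj ∧ IsTrim tj (D.part j)

/-- Two decompositions of `G` are the same: equal `s`, and, up to a bijection `σ` of the index
sets, the same parts, both up to isomorphism and as pieces of `G`. -/
def JoinDecomposition.Same {V : Type u} {G : SimpleGraph V}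
    (D : JoinDecomposition.{u, u} G) (D' : JoinDecomposition.{u, v} G) : Prop :=
  D.s = D'.s ∧ ∃ (σ : Fin D.r ≃ Fin D'.r) (f : ∀ j, D.part j ≃g D'.part (σ j)),
    ∀ j (x : D.W j), D'.iso (Sum.inr ⟨σ j, f j x⟩) = D.iso (Sum.inr ⟨j, x⟩)

end SimpleGraph

/-! Let π(G) be the path cover number, the least number of disjoint paths that cover V(G). For l ≥
1, deleting K_l from a Hamiltonian cycle of K_l ∗ G leaves at most l paths of G, and conversely the
vertices of K_l close up any cover by at most l paths. So K_l ∗ G is Hamiltonian iff π(G) ≤ l, and π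
= μ̌ + i_H (`muCheck_add_hamIndicator`). Since π is additive over disjoint unions and joining K_s
lowers μ̌ by s (but not below 0), the formula for t follows once H is the graph on the nonuniversal
vertices and the G_j are its components.

Maximality passes from G to H. If H is connected, it is the only part. Otherwise an edge added
inside G_j must lower π(G_j), and the point is that an incomplete G_j has no universal vertex x. As
π(G_j) ≥ 2, such an x is never the end of a path in a minimum cover, because another path of G_j
could be attached there (`pathCover_lt_of_cons`). Hence an edge from x to another component does not
lower π (`pathCover_sup_edge_of_forall_adj`), against maximality.

For uniqueness, a union of complete or trim parts has a universal vertex only if G is complete,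
which t > 0 excludes. So K_s must be the set of universal vertices, and the parts are the components
of the rest.

A path cover is encoded as one list of the vertices, cut wherever consecutive entries are not
adjacent; π is the minimum of `numPaths` over all such lists. -/

namespace SimpleGraph

/-! ### Path covers: universal vertices, disjoint unions, added edges -/

section PathCover

variable {V : Type*} {G : SimpleGraph V}

open Classical in
/-- The number of paths into which the list `L` falls apart when it is cut between consecutive
vertices that are not adjacent in `G`. -/
noncomputable def numPaths (G : SimpleGraph V) : List V → ℕ
  | [] => 0
  | [_] => 1
  | a :: b :: L => numPaths G (b :: L) + if G.Adj a b then 0 else 1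

@[simp] lemma numPaths_nil : G.numPaths [] = 0 := rfl

@[simp] lemma numPaths_singleton (a : V) : G.numPaths [a] = 1 := rfl

open Classical in
lemma numPaths_cons_cons (a b : V) (L : List V) :
    G.numPaths (a :: b :: L) = G.numPaths (b :: L) + if G.Adj a b then 0 else 1 := rfl

lemma numPaths_cons_cons_of_adj {a b : V} (h : G.Adj a b) (L : List V) :
    G.numPaths (a :: b :: L) = G.numPaths (b :: L) := by simp [numPaths_cons_cons, h]

lemma numPaths_cons_pos (a : V) (L : List V) : 0 < G.numPaths (a :: L) := by
  induction L generalizing a with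
  | nil => simp
  | cons b L ih => rw [numPaths_cons_cons]; have := ih b; omega

lemma numPaths_pos {L : List V} (h : L ≠ []) : 0 < G.numPaths L := by
  obtain ⟨a, L, rfl⟩ := List.exists_cons_of_ne_nil h
  exact numPaths_cons_pos a L

lemma numPaths_cons_le (a : V) (L : List V) : G.numPaths (a :: L) ≤ G.numPaths L + 1 := by
  cases L with
  | nil => simp
  | cons b L => rw [numPaths_cons_cons]; split_ifs <;> omega

lemma numPaths_le_cons (a : V) (L : List V) : G.numPaths L ≤ G.numPaths (a :: L) := by
  cases L with
  | nil => simp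
  | cons b L => rw [numPaths_cons_cons]; omega

-- Cutting between x and y affects only that junction: it costs an extra path exactly when x and y
-- are adjacent. The estimates for concatenation and reversal rest on this.
open Classical in
lemma numPaths_append_cons_cons (A B : List V) (x y : V) :
    G.numPaths (A ++ x :: y :: B) + (if G.Adj x y then 1 else 0) =
      G.numPaths (A ++ [x]) + G.numPaths (y :: B) := by
  induction A with
  | nil => simp only [List.nil_append, numPaths_cons_cons, numPaths_singleton]; split_ifs <;> omega
  | cons a A ih =>
    cases A with
    | nil =>
      simp only [List.nil_append, List.cons_append, numPaths_cons_cons, numPaths_singleton] at ih ⊢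
      omega
    | cons b A =>
      simp only [List.cons_append, numPaths_cons_cons] at ih ⊢
      omega

lemma numPaths_append_of_adj {x y : V} (h : G.Adj x y) (A B : List V) :
    G.numPaths (A ++ x :: y :: B) + 1 = G.numPaths (A ++ [x]) + G.numPaths (y :: B) := by
  simpa [h] using numPaths_append_cons_cons (G := G) A B x y

lemma numPaths_append_le (A B : List V) :
    G.numPaths (A ++ B) ≤ G.numPaths A + G.numPaths B := by
  induction A using List.reverseRecOn with
  | nil => simp
  | append_singleton A x =>
    cases B with
    | nil => simp
    | cons y B =>
      have := numPaths_append_cons_cons (G := G) A B x y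
      simp only [List.append_assoc, List.cons_append, List.nil_append]
      omega

lemma numPaths_reverse (L : List V) : G.numPaths L.reverse = G.numPaths L := by
  classical
  induction L with
  | nil => rfl
  | cons a L ih =>
    cases L with
    | nil => rfl
    | cons b L =>
      have := numPaths_append_cons_cons (G := G) L.reverse [] b a
      simp only [List.reverse_cons, List.append_assoc, List.cons_append, List.nil_append,
        numPaths_singleton] at this ih ⊢
      rw [numPaths_cons_cons, ← ih]
      rw [G.adj_comm b a] at this
      split_ifs at this ⊢ <;> omega

lemma numPaths_le_one_iff (L : List V) : G.numPaths L ≤ 1 ↔ L.IsChain G.Adj := by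
  induction L with
  | nil => simp
  | cons a L ih =>
    cases L with
    | nil => simp
    | cons b L =>
      rw [numPaths_cons_cons, List.isChain_cons_cons, ← ih]
      have := numPaths_cons_pos (G := G) b L
      split_ifs with h <;> simp only [h, true_and, false_and, iff_false] <;> omega

/-- The cut is made between nonadjacent consecutive vertices, so no path is split. -/
lemma exists_append_of_two_le_numPaths {L : List V} (h : 2 ≤ G.numPaths L) :
    ∃ A B, A ≠ [] ∧ B ≠ [] ∧ L = A ++ B ∧ G.numPaths L = G.numPaths A + G.numPaths B := by
  induction L with
  | nil => simp at h
  | cons a L ih =>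
    cases L with
    | nil => simp at h
    | cons b L =>
      by_cases hab : G.Adj a b
      · rw [numPaths_cons_cons_of_adj hab] at h ⊢
        obtain ⟨A, B, hA, hB, hL, hn⟩ := ih h
        obtain ⟨c, A, rfl⟩ := List.exists_cons_of_ne_nil hA
        obtain rfl : b = c := by simpa using (List.cons.inj hL).1
        exact ⟨a :: b :: A, B, by simp, hB, by simp [hL],
          by rw [numPaths_cons_cons_of_adj hab, hn]⟩
      · exact ⟨[a], b :: L, by simp, by simp, rfl, by simp [numPaths_cons_cons, hab, add_comm]⟩

lemma numPaths_congr {G' : SimpleGraph V} {L : List V}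
    (h : ∀ a ∈ L, ∀ b ∈ L, (G.Adj a b ↔ G'.Adj a b)) : G.numPaths L = G'.numPaths L := by
  induction L with
  | nil => rfl
  | cons a L ih =>
    cases L with
    | nil => rfl
    | cons b L =>
      rw [numPaths_cons_cons, numPaths_cons_cons,
        ih fun x hx y hy => h x (List.mem_cons_of_mem _ hx) y (List.mem_cons_of_mem _ hy)]
      have := h a (by simp) b (by simp)
      split_ifs <;> tauto

lemma numPaths_map {W : Type*} {H : SimpleGraph W} (f : W ↪ V)
    (hf : ∀ a b, G.Adj (f a) (f b) ↔ H.Adj a b) (L : List W) :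
    G.numPaths (L.map f) = H.numPaths L := by
  induction L with
  | nil => rfl
  | cons a L ih =>
    cases L with
    | nil => rfl
    | cons b L =>
      simp only [List.map_cons, numPaths_cons_cons] at ih ⊢
      rw [ih]
      have := hf a b
      split_ifs <;> tauto

lemma numPaths_cons_of_isUniversal {a : V} (ha : G.IsUniversal a) {L : List V} (hL : L ≠ [])
    (haL : a ∉ L) : G.numPaths (a :: L) = G.numPaths L := by
  obtain ⟨b, L, rfl⟩ := List.exists_cons_of_ne_nil hL
  exact numPaths_cons_cons_of_adj (ha (by rintro rfl; simp at haL)) L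

/-- Joining the two lists at adjacent ends. -/
lemma numPaths_append_of_getLast_adj_head {A B : List V} (hA : A ≠ []) (hB : B ≠ [])
    (h : G.Adj (A.getLast hA) (B.head hB)) :
    G.numPaths (A ++ B) + 1 = G.numPaths A + G.numPaths B := by
  obtain ⟨b, B, rfl⟩ := List.exists_cons_of_ne_nil hB
  induction A using List.reverseRecOn with
  | nil => exact absurd rfl hA
  | append_singleton A a =>
    simp only [List.getLast_append_singleton, List.head_cons] at h
    simpa using numPaths_append_of_adj h A B

lemma numPaths_append_cons_of_isUniversal {a : V} (ha : G.IsUniversal a) {A B : List V}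
    (hA : A ≠ []) (hB : B ≠ []) (haA : a ∉ A) (haB : a ∉ B) :
    G.numPaths (A ++ a :: B) + 1 = G.numPaths A + G.numPaths B := by
  rw [numPaths_append_of_getLast_adj_head hA (by simp)
    (ha fun h => haA (h ▸ List.getLast_mem hA)).symm,
    numPaths_cons_of_isUniversal ha hB haB]

/-- Vertices of different colours are never adjacent, so cutting a list into its colour classes
creates no more paths. -/
lemma sum_numPaths_filter_le {ι : Type*} [Fintype ι] [DecidableEq ι] (c : V → ι)
    (hc : ∀ a b, G.Adj a b → c a = c b) (L : List V) :
    ∑ j, G.numPaths (L.filter (c · = j)) ≤ G.numPaths L := by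
  induction L with
  | nil => simp
  | cons a L ih =>
    rw [← Finset.add_sum_erase _ _ (Finset.mem_univ (c a))] at ih ⊢
    have hrest : ∑ j ∈ Finset.univ.erase (c a), G.numPaths ((a :: L).filter (c · = j)) =
        ∑ j ∈ Finset.univ.erase (c a), G.numPaths (L.filter (c · = j)) := by
      refine Finset.sum_congr rfl fun j hj => ?_
      rw [List.filter_cons_of_neg (by simpa using (Finset.ne_of_mem_erase hj).symm)]
    rw [hrest, List.filter_cons_of_pos (by simp)]
    have h1 := numPaths_cons_le (G := G) a (L.filter (c · = c a))
    cases L with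
    | nil => simp
    | cons b L =>
      by_cases hab : G.Adj a b
      · rw [numPaths_cons_cons_of_adj hab]
        rw [List.filter_cons_of_pos (by simp [hc a b hab])] at ih ⊢
        rwa [numPaths_cons_cons_of_adj hab]
      · rw [numPaths_cons_cons, if_neg hab]
        omega

/-- The count sees only consecutive pairs, so the new edge matters only where x and y stand next to
each other. -/
lemma numPaths_sup_edge_eq_or (x y : V) (L : List V) :
    G.numPaths L = (G ⊔ edge x y).numPaths L ∨
      ∃ A B, L = A ++ x :: y :: B ∨ L = A ++ y :: x :: B := by
  induction L with
  | nil => exact .inl rfl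
  | cons a L ih =>
    cases L with
    | nil => exact .inl rfl
    | cons b L =>
      by_cases h : (edge x y).Adj a b
      · right
        rw [edge_adj] at h
        obtain ⟨⟨rfl, rfl⟩ | ⟨rfl, rfl⟩, -⟩ := h
        · exact ⟨[], L, .inl rfl⟩
        · exact ⟨[], L, .inr rfl⟩
      · rcases ih with ih | ⟨A, B, ih | ih⟩
        · left
          rw [numPaths_cons_cons, numPaths_cons_cons, ih]
          have : (G ⊔ edge x y).Adj a b ↔ G.Adj a b := by simp [h]
          split_ifs <;> tauto
        · exact .inr ⟨a :: A, B, .inl (by rw [ih]; rfl)⟩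
        · exact .inr ⟨a :: A, B, .inr (by rw [ih]; rfl)⟩

/-- `L` lists the elements of `S`, each of them once. -/
def IsListing (S : Set V) (L : List V) : Prop := L.Nodup ∧ ∀ a, a ∈ L ↔ a ∈ S

/-- The path cover number of `G[S]`: the least number of disjoint paths that cover `S`. -/
noncomputable def pathCover (G : SimpleGraph V) (S : Set V) : ℕ :=
  sInf {k | ∃ L, IsListing S L ∧ G.numPaths L = k}

lemma exists_isListing [Finite V] (S : Set V) : ∃ L, IsListing S L := by
  have := Fintype.ofFinite V
  classical
  exact ⟨S.toFinset.toList, Finset.nodup_toList _, by simp⟩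

lemma IsListing.pathCover_le {S : Set V} {L : List V} (h : IsListing S L) :
    G.pathCover S ≤ G.numPaths L := Nat.sInf_le ⟨L, h, rfl⟩

lemma exists_isListing_numPaths_eq [Finite V] (G : SimpleGraph V) (S : Set V) :
    ∃ L, IsListing S L ∧ G.numPaths L = G.pathCover S :=
  Nat.sInf_mem (s := {k | ∃ L, IsListing S L ∧ G.numPaths L = k})
    ((exists_isListing S).imp' G.numPaths fun L h => ⟨L, h, rfl⟩)

lemma pathCover_le_iff [Finite V] {S : Set V} {k : ℕ} :
    G.pathCover S ≤ k ↔ ∃ L, IsListing S L ∧ G.numPaths L ≤ k := by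
  constructor
  · intro h
    obtain ⟨L, hL, hn⟩ := exists_isListing_numPaths_eq G S
    exact ⟨L, hL, hn ▸ h⟩
  · rintro ⟨L, hL, hn⟩
    exact hL.pathCover_le.trans hn

lemma IsListing.of_perm {S : Set V} {L L' : List V} (h : IsListing S L) (hp : L'.Perm L) :
    IsListing S L' :=
  ⟨hp.nodup_iff.mpr h.1, fun a => hp.mem_iff.trans (h.2 a)⟩

lemma IsListing.ne_nil {S : Set V} {L : List V} (h : IsListing S L) (hS : S.Nonempty) :
    L ≠ [] := by
  rintro rfl
  obtain ⟨a, ha⟩ := hS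
  simpa using (h.2 a).mpr ha

lemma pathCover_pos [Finite V] {S : Set V} (hS : S.Nonempty) : 0 < G.pathCover S := by
  obtain ⟨L, hL, hn⟩ := exists_isListing_numPaths_eq G S
  exact hn ▸ numPaths_pos (hL.ne_nil hS)

lemma pathCover_union_le [Finite V] {S T : Set V} (h : Disjoint S T) :
    G.pathCover (S ∪ T) ≤ G.pathCover S + G.pathCover T := by
  obtain ⟨L, hL, hn⟩ := exists_isListing_numPaths_eq G S
  obtain ⟨M, hM, hm⟩ := exists_isListing_numPaths_eq G T
  rw [← hn, ← hm]
  refine le_trans (IsListing.pathCover_le ⟨?_, fun a => ?_⟩) (numPaths_append_le L M)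
  · rw [List.nodup_append']
    exact ⟨hL.1, hM.1, fun a ha hb => h.notMem_of_mem_left ((hL.2 a).1 ha) ((hM.2 a).1 hb)⟩
  · simp [hL.2, hM.2]

lemma IsListing.map {W : Type*} {S : Set W} {L : List W} (h : IsListing S L) (f : W ↪ V) :
    IsListing (f '' S) (L.map f) :=
  ⟨h.1.map f.injective, fun a => by simp [h.2]⟩

lemma pathCover_image {W : Type*} [Finite W] [Finite V] {H : SimpleGraph W} (f : W ↪ V)
    (hf : ∀ a b, G.Adj (f a) (f b) ↔ H.Adj a b) (S : Set W) :
    G.pathCover (f '' S) = H.pathCover S := by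
  apply le_antisymm
  · obtain ⟨L, hL, hn⟩ := exists_isListing_numPaths_eq H S
    rw [← hn, ← numPaths_map f hf]
    exact (hL.map f).pathCover_le
  · obtain ⟨L, hL, hn⟩ := exists_isListing_numPaths_eq G (f '' S)
    obtain ⟨L, rfl⟩ : ∃ L', List.map f L' = L := by
      rw [← Set.mem_range, Set.range_list_map]
      rintro a ha
      obtain ⟨b, -, rfl⟩ := (hL.2 a).1 ha
      exact ⟨b, rfl⟩
    rw [numPaths_map f hf] at hn
    rw [← hn]
    refine IsListing.pathCover_le ⟨hL.1.of_map, fun a => ?_⟩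
    simpa using hL.2 (f a)

/-- A universal vertex glues two paths into one, and its removal splits at most one path in two. For
m = 0 the equivalence fails if one path covers `S`. The threshold form iterates without truncated
subtraction. -/
lemma pathCover_insert_of_isUniversal [Finite V] {a : V} (ha : G.IsUniversal a) {S : Set V}
    (haS : a ∉ S) {m : ℕ} (hm : 1 ≤ m) :
    G.pathCover (insert a S) ≤ m ↔ G.pathCover S ≤ m + 1 := by
  simp only [pathCover_le_iff]
  constructor
  · rintro ⟨L, hL, hn⟩
    obtain ⟨A, B, rfl⟩ := List.append_of_mem ((hL.2 a).2 (Set.mem_insert _ _))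
    have hnd : (a :: (A ++ B)).Nodup := List.nodup_middle.1 hL.1
    rw [List.nodup_cons, List.mem_append, not_or] at hnd
    refine ⟨A ++ B, ⟨hnd.2, fun b => ?_⟩, ?_⟩
    · have := hL.2 b
      by_cases hb : b = a
      · subst hb; simp [haS, hnd.1]
      · simpa [hb] using this
    · have := numPaths_append_le (G := G) A B
      by_cases hA : A = []
      · subst hA
        have := numPaths_le_cons (G := G) a B
        simp only [List.nil_append] at hn ⊢
        omega
      by_cases hB : B = []
      · subst hB
        have h1 := numPaths_le_cons (G := G) a A.reverse
        rw [← numPaths_reverse, List.reverse_append] at hn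
        simp only [List.reverse_cons, List.reverse_nil, List.nil_append,
          List.singleton_append, numPaths_reverse] at hn h1
        rw [List.append_nil]
        omega
      have := numPaths_append_cons_of_isUniversal ha hA hB hnd.1.1 hnd.1.2
      omega
  · rintro ⟨L, hL, hn⟩
    have haL : a ∉ L := fun h => haS ((hL.2 a).1 h)
    have hins : IsListing (insert a S) (a :: L) :=
      ⟨List.nodup_cons.2 ⟨haL, hL.1⟩, fun b => by simp [hL.2]⟩
    by_cases h2 : 2 ≤ G.numPaths L
    · obtain ⟨A, B, hA, hB, rfl, hAB⟩ := exists_append_of_two_le_numPaths h2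
      refine ⟨A ++ a :: B, hins.of_perm List.perm_middle, ?_⟩
      rw [List.mem_append, not_or] at haL
      have := numPaths_append_cons_of_isUniversal ha hA hB haL.1 haL.2
      omega
    · refine ⟨a :: L, hins, ?_⟩
      by_cases hL0 : L = []
      · subst hL0; simpa using hm
      · rw [numPaths_cons_of_isUniversal ha hL0 haL]
        omega

lemma pathCover_union_of_isUniversal [Finite V] {S : Set V} (U : Finset V)
    (hU : ∀ a ∈ U, G.IsUniversal a) (hS : ∀ a ∈ U, a ∉ S) {m : ℕ} (hm : 1 ≤ m) :
    G.pathCover (U ∪ S) ≤ m ↔ G.pathCover S ≤ m + U.card := by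
  classical
  induction U using Finset.induction_on generalizing m with
  | empty => simp
  | insert a U ha ih =>
    rw [Finset.coe_insert, Set.insert_union, pathCover_insert_of_isUniversal (hU a (by simp)) _ hm,
      ih (fun b hb => hU b (by simp [hb])) (fun b hb => hS b (by simp [hb])) (by omega),
      Finset.card_insert_of_notMem ha, add_assoc, add_comm 1]
    simpa [ha] using hS a (by simp)

/-- The path cover number is additive over colour classes between which there are no edges. -/
lemma pathCover_univ_eq_sum [Finite V] {ι : Type*} [Fintype ι] (c : V → ι)
    (hc : ∀ a b, G.Adj a b → c a = c b) :
    G.pathCover Set.univ = ∑ j, G.pathCover (c ⁻¹' {j}) := by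
  classical
  apply le_antisymm
  · have h : ∀ s : Finset ι, G.pathCover (c ⁻¹' s) ≤ ∑ j ∈ s, G.pathCover (c ⁻¹' {j}) := by
      intro s
      induction s using Finset.induction_on with
      | empty =>
        simpa using IsListing.pathCover_le (G := G) (S := ∅) (L := []) ⟨List.nodup_nil, by simp⟩
      | insert j s hj ih =>
        rw [Finset.sum_insert hj, Finset.coe_insert, Set.insert_eq, Set.preimage_union]
        refine (pathCover_union_le ?_).trans (Nat.add_le_add_left ih _)
        exact Disjoint.preimage c (by simpa using hj)
    simpa using h Finset.univ
  · obtain ⟨L, hL, hn⟩ := exists_isListing_numPaths_eq G Set.univ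
    rw [← hn]
    refine le_trans (Finset.sum_le_sum fun j _ => ?_) (sum_numPaths_filter_le c hc L)
    exact IsListing.pathCover_le ⟨hL.1.filter _, fun a => by simp [hL.2]⟩

/-- In a minimum path cover, no end of a path is adjacent to all the other vertices of its
colour class, unless one path suffices for that class. -/
lemma pathCover_lt_of_cons [Finite V] {ι : Type*} [Fintype ι] (c : V → ι)
    (hc : ∀ a b, G.Adj a b → c a = c b) {x : V} (hx : ∀ y, c y = c x → x ≠ y → G.Adj x y)
    (h2 : 2 ≤ G.pathCover (c ⁻¹' {c x})) {L : List V} (hL : IsListing Set.univ (x :: L)) :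
    G.pathCover Set.univ < G.numPaths (x :: L) := by
  classical
  have hlist : ∀ j, IsListing (c ⁻¹' {j}) ((x :: L).filter (c · = j)) := fun j =>
    ⟨hL.1.filter _, fun a => by rw [List.mem_filter, hL.2]; simp⟩
  rw [pathCover_univ_eq_sum c hc]
  -- Strictness is needed only in the class of `x`.
  refine lt_of_lt_of_le ?_ (sum_numPaths_filter_le c hc (x :: L))
  refine Finset.sum_lt_sum (fun j _ => (hlist j).pathCover_le) ⟨c x, Finset.mem_univ _, ?_⟩
  have hl := hlist (c x)
  rw [List.filter_cons_of_pos (by simp)] at hl ⊢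
  obtain ⟨A, B, hA, hB, hAB, hn⟩ := exists_append_of_two_le_numPaths (h2.trans hl.pathCover_le)
  obtain ⟨a, A, rfl⟩ := List.exists_cons_of_ne_nil hA
  obtain rfl : x = a := (List.cons.inj hAB).1
  rw [hAB] at hl
  -- The last vertex of `B` lies in the class of `x`, hence is adjacent to `x`; putting `B` before
  -- `x :: A` saves a path.
  have hadj : G.Adj (B.getLast hB) ((x :: A).head hA) := by
    rw [List.head_cons]
    have hmem := List.getLast_mem hB
    refine (hx _ ((hl.2 _).1 (List.mem_append_right _ hmem)) ?_).symm
    rintro h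
    exact (List.nodup_append'.1 hl.1).2.2 (List.mem_cons_self) (h ▸ hmem)
  have h1 := numPaths_append_of_getLast_adj_head hB hA hadj
  have h3 := (hl.of_perm List.perm_append_comm).pathCover_le (G := G) (L := B ++ x :: A)
  omega

/-- Adding an edge between different colour classes at a vertex that is adjacent to its whole
colour class does not lower the path cover number. -/
lemma pathCover_sup_edge_of_forall_adj [Finite V] {ι : Type*} [Fintype ι] (c : V → ι)
    (hc : ∀ a b, G.Adj a b → c a = c b) {x y : V} (hxy : c x ≠ c y)
    (hx : ∀ y, c y = c x → x ≠ y → G.Adj x y) (h2 : 2 ≤ G.pathCover (c ⁻¹' {c x})) :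
    G.pathCover Set.univ ≤ (G ⊔ edge x y).pathCover Set.univ := by
  -- Cut at the new edge and swap the halves, so that `x` comes first. Neither half contains the new
  -- edge. The cut costs at most one path, and a list headed by `x` has at least one path too many
  -- for `G`, which makes up for it.
  have key : ∀ A B : List V, IsListing Set.univ (A ++ y :: x :: B) →
      G.pathCover Set.univ ≤ (G ⊔ edge x y).numPaths (A ++ y :: x :: B) := by
    intro A B hL
    have hne : x ≠ y := fun h => hxy (h ▸ rfl)
    have h1 := numPaths_append_of_adj (G := G ⊔ edge x y) (x := y) (y := x)
      (by simp [edge_adj, hne.symm]) A B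
    have hp : (x :: B ++ (A ++ [y])).Perm (A ++ y :: x :: B) := by
      simpa using List.perm_append_comm (l₁ := x :: B) (l₂ := A ++ [y])
    have hL' := hL.of_perm hp
    have hnd := List.nodup_append'.1 hL'.1
    have h3 : G.numPaths (x :: B) = (G ⊔ edge x y).numPaths (x :: B) := by
      refine numPaths_congr fun a ha b hb => ?_
      have hy : y ∉ x :: B := fun h => hnd.2.2 h (by simp)
      have hay : a ≠ y := fun h => hy (h ▸ ha)
      have hby : b ≠ y := fun h => hy (h ▸ hb)
      simp [edge_adj, hay, hby]
    have h4 : G.numPaths (A ++ [y]) = (G ⊔ edge x y).numPaths (A ++ [y]) := by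
      refine numPaths_congr fun a ha b hb => ?_
      have hy : x ∉ A ++ [y] := fun h => hnd.2.2 (by simp) h
      have hax : a ≠ x := fun h => hy (h ▸ ha)
      have hbx : b ≠ x := fun h => hy (h ▸ hb)
      simp [edge_adj, hax, hbx]
    have h5 := pathCover_lt_of_cons c hc hx h2 hL'
    have h6 := numPaths_append_le (G := G) (x :: B) (A ++ [y])
    have h7 := h5.trans_le h6
    omega
  obtain ⟨L, hL, hn⟩ := exists_isListing_numPaths_eq (G ⊔ edge x y) Set.univ
  rw [← hn]
  rcases numPaths_sup_edge_eq_or (G := G) x y L with h | ⟨A, B, rfl | rfl⟩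
  · exact h ▸ hL.pathCover_le
  · rw [← numPaths_reverse]
    have := key B.reverse A.reverse
    simp only [List.reverse_append, List.reverse_cons, List.append_assoc, List.cons_append,
      List.nil_append] at this ⊢
    exact this (hL.of_perm (by simpa using List.reverse_perm (A ++ x :: y :: B)))
  · exact key A B hL

end PathCover

/-! ### Hamiltonicity as a path cover condition -/

section Hamiltonian

variable {V : Type*} [Fintype V] {G : SimpleGraph V}

/-- The vertices of a Hamiltonian graph can be listed along a closed walk from any vertex. -/
lemma IsHam.exists_isListing (h : G.IsHam) (u : V) :
    ∃ L, IsListing {u}ᶜ L ∧ G.numPaths L ≤ 1 ∧ G.numPaths (L ++ [u]) ≤ 1 := by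
  classical
  rcases h with h | ⟨h2, rfl⟩
  -- `IsHamiltonian` provides no cycle on a single vertex; there the list is empty.
  · by_cases h1 : Fintype.card V = 1
    · have := (Fintype.card_le_one_iff_subsingleton.1 h1.le)
      exact ⟨[], ⟨List.nodup_nil, fun a => by simpa using Subsingleton.elim a u⟩, by simp, by simp⟩
    · have : Nontrivial V := Fintype.one_lt_card_iff_nontrivial.1
        (lt_of_le_of_ne (Fintype.card_pos_iff.2 ⟨u⟩) (Ne.symm h1))
      obtain ⟨p, hp⟩ := h.exists_isHamiltonianCycle u
      cases p with
      | nil => exact absurd rfl hp.ne_nil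
      | cons hadj q =>
        have hq : q.IsHamiltonian := by
          intro a
          convert hp.isHamiltonian_tail a using 1
          simp
        -- Without its first vertex the cycle is a path through all vertices that ends at `u`; the
        -- required list is this path without its end.
        have hsupp : q.support = q.support.dropLast ++ [u] := by
          conv_lhs => rw [← List.dropLast_append_getLast q.support_ne_nil, q.getLast_support]
        have hnd := hq.isPath.support_nodup
        have hchain := q.isChain_adj_support
        have hmem := hq.mem_support
        rw [hsupp] at hnd hchain hmem
        generalize q.support.dropLast = L at *
        have hu : u ∉ L := by
          intro hu
          exact (List.nodup_append'.1 hnd).2.2 hu (by simp)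
        refine ⟨L, ⟨(List.nodup_append'.1 hnd).1, fun a => ⟨fun ha => ?_, fun ha => ?_⟩⟩, ?_, ?_⟩
        · rintro rfl
          exact hu ha
        · simpa [show a ≠ u from ha] using hmem a
        · exact (numPaths_le_one_iff L).2 hchain.left_of_append
        · exact (numPaths_le_one_iff _).2 hchain
  · obtain ⟨L, hL⟩ := SimpleGraph.exists_isListing ({u}ᶜ : Set V)
    have hnd : (L ++ [u]).Nodup :=
      List.nodup_append'.2 ⟨hL.1, by simp, by simpa using (hL.2 u).not.2 (by simp)⟩
    refine ⟨L, hL, ?_, ?_⟩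
    · exact (numPaths_le_one_iff L).2 (hL.1.isChain.imp fun a b h => h)
    · exact (numPaths_le_one_iff _).2 (hnd.isChain.imp fun a b h => h)

lemma IsHam.pathCover_le_one [Nonempty V] (h : G.IsHam) : G.pathCover Set.univ ≤ 1 := by
  obtain ⟨u⟩ := ‹Nonempty V›
  obtain ⟨L, hL, -, hn⟩ := h.exists_isListing u
  refine le_trans (IsListing.pathCover_le (L := L ++ [u]) ⟨?_, fun a => ?_⟩) hn
  · exact List.nodup_append'.2 ⟨hL.1, by simp, by simpa using (hL.2 u).not.2 (by simp)⟩
  · by_cases h : a = u <;> simp [hL.2, h]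

/-- The universal vertex closes the path `L` up to a cycle. A cycle needs three vertices, so an `L`
with no or one entry gives the conventional cases K₁ and K₂. -/
lemma isHam_of_isListing {u : V} (hu : G.IsUniversal u) {L : List V} (hL : IsListing {u}ᶜ L)
    (hn : G.numPaths L ≤ 1) : G.IsHam := by
  classical
  have huL : u ∉ L := fun h => by simpa using (hL.2 u).1 h
  have hnd : (u :: L).Nodup := List.nodup_cons.2 ⟨huL, hL.1⟩
  have hmem : ∀ a, a ∈ u :: L := fun a => by by_cases h : a = u <;> simp [hL.2, h]
  have hcard : Fintype.card V = L.length + 1 := by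
    rw [← List.length_cons (a := u), ← List.toFinset_card_of_nodup hnd, ← Finset.card_univ]
    congr 1
    ext a
    simpa using hmem a
  rw [numPaths_le_one_iff] at hn
  match L, hn with
  | [], _ => exact .inl (IsHamiltonian.of_card_eq_one hcard)
  | [b], _ =>
    refine .inr ⟨hcard, ?_⟩
    rw [eq_top_iff_forall_isUniversal]
    intro v w hvw
    have hv := hmem v
    have hw := hmem w
    simp only [List.mem_cons, List.not_mem_nil, or_false] at hv hw
    have hub : G.Adj u b := hu (by rintro rfl; simp at huL)
    rcases hv with rfl | rfl <;> rcases hw with rfl | rfl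
    · exact absurd rfl hvw
    · exact hub
    · exact hub.symm
    · exact absurd rfl hvw
  | b :: c :: L, hn =>
    refine .inl fun _ => ⟨u, ?_⟩
    have hub : G.Adj u b := hu (by rintro rfl; simp at huL)
    have hchain : ((b :: c :: L) ++ [u]).IsChain G.Adj := by
      rw [← numPaths_le_one_iff, ← numPaths_reverse, List.reverse_append]
      rw [← numPaths_le_one_iff, ← numPaths_reverse] at hn
      exact (numPaths_cons_of_isUniversal hu (by simp) (mt List.mem_reverse.1 huL)).trans_le hn
    obtain ⟨x, y, q, hq⟩ : ∃ x y, ∃ q : G.Walk x y, q.support = (b :: c :: L) ++ [u] :=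
      ⟨_, _, Walk.ofSupport _ (by simp) hchain, Walk.support_ofSupport _ _⟩
    obtain rfl : b = x := by
      have := q.head_support
      simp only [hq] at this
      simpa using this
    obtain rfl : u = y := by
      have := q.getLast_support
      simp only [hq] at this
      simpa using this
    have hperm : (b :: c :: L ++ [u]).Perm (u :: b :: c :: L) := List.perm_append_singleton _ _
    have hqpath : q.IsPath := by
      rw [Walk.isPath_def, hq, hperm.nodup_iff]
      exact hnd
    have hlen : q.length + 1 = L.length + 3 := by
      rw [← Walk.length_support, hq]
      simp
    refine ⟨Walk.cons hub q, ?_⟩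
    rw [Walk.isHamiltonianCycle_iff_isCycle_and_length_eq,
      Walk.isCycle_iff_isPath_tail_and_le_length]
    refine ⟨⟨by simpa using hqpath, ?_⟩, ?_⟩
    · rw [Walk.length_cons]; omega
    · rw [Walk.length_cons, hcard, hlen]; simp

lemma isHam_iff_pathCover_of_isUniversal {u : V} (hu : G.IsUniversal u) :
    G.IsHam ↔ G.pathCover {u}ᶜ ≤ 1 := by
  rw [pathCover_le_iff]
  constructor
  · intro h
    obtain ⟨L, hL, hn, -⟩ := h.exists_isListing u
    exact ⟨L, hL, hn⟩
  · rintro ⟨L, hL, hn⟩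
    exact isHam_of_isListing hu hL hn

lemma isHam_top [Nonempty V] : (⊤ : SimpleGraph V).IsHam := by
  obtain ⟨u⟩ := ‹Nonempty V›
  obtain ⟨L, hL⟩ := exists_isListing ({u}ᶜ : Set V)
  exact isHam_of_isListing (u := u) (fun _ h => h) hL
    ((numPaths_le_one_iff L).2 (hL.1.isChain.imp fun a b h => h))

lemma IsHam.of_iso {W : Type*} [Fintype W] {H : SimpleGraph W} (e : G ≃g H) (h : G.IsHam) :
    H.IsHam := by
  classical
  have hc := Fintype.card_congr e.toEquiv
  rcases h with h | ⟨h, rfl⟩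
  · left
    intro h1
    obtain ⟨a, p, hp⟩ := h (hc ▸ h1)
    refine ⟨e a, p.map e.toHom, ?_⟩
    convert hp.map (f := e.toHom) e.bijective
  · right
    refine ⟨hc ▸ h, ?_⟩
    rw [eq_top_iff_forall_isUniversal]
    intro v w hvw
    rw [← e.symm.map_adj_iff]
    exact fun h => hvw (e.symm.injective h)

lemma isHam_congr {W : Type*} [Fintype W] {H : SimpleGraph W} (e : G ≃g H) :
    G.IsHam ↔ H.IsHam := ⟨.of_iso e, .of_iso e.symm⟩

end Hamiltonian

/-! ### Joins -/

section Join

variable {V W : Type*} {G : SimpleGraph V} {H : SimpleGraph W}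

@[simp] lemma graphJoin_adj_inl_inl {a b : V} :
    (graphJoin G H).Adj (.inl a) (.inl b) ↔ G.Adj a b := by simp [graphJoin]

@[simp] lemma graphJoin_adj_inr_inr {a b : W} :
    (graphJoin G H).Adj (.inr a) (.inr b) ↔ H.Adj a b := by simp [graphJoin]

@[simp] lemma graphJoin_adj_inl_inr {a : V} {b : W} :
    (graphJoin G H).Adj (.inl a) (.inr b) := by simp [graphJoin]

@[simp] lemma graphJoin_adj_inr_inl {a : V} {b : W} :
    (graphJoin G H).Adj (.inr b) (.inl a) := by simp [graphJoin]

/-- Isomorphisms of the two graphs induce an isomorphism of their joins. -/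
def graphJoinCongr {V' W' : Type*} {G' : SimpleGraph V'} {H' : SimpleGraph W'} (e : G ≃g G')
    (f : H ≃g H') : graphJoin G H ≃g graphJoin G' H' where
  toEquiv := e.toEquiv.sumCongr f.toEquiv
  map_rel_iff' {a b} := by
    rcases a with a | a <;> rcases b with b | b
    · simpa using e.map_rel_iff
    · simp
    · simp
    · simpa using f.map_rel_iff

/-- `K_l ∗ (K_s ∗ H)` is `K_{l+s} ∗ H`. -/
def graphJoinTopAssoc (l s : ℕ) (H : SimpleGraph W) :
    graphJoin (⊤ : SimpleGraph (Fin l)) (graphJoin (⊤ : SimpleGraph (Fin s)) H) ≃g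
      graphJoin (⊤ : SimpleGraph (Fin (l + s))) H where
  toEquiv := (Equiv.sumAssoc _ _ _).symm.trans (finSumFinEquiv.sumCongr (Equiv.refl W))
  map_rel_iff' {a b} := by
    rcases a with a | a | a <;> rcases b with b | b | b <;>
      simp [-finSumFinEquiv_apply_left, -finSumFinEquiv_apply_right]

/-- `K_0 ∗ H` is `H`. -/
def graphJoinZero (H : SimpleGraph W) : graphJoin (⊤ : SimpleGraph (Fin 0)) H ≃g H where
  toEquiv := Equiv.emptySum (Fin 0) W
  map_rel_iff' {a b} := by
    rcases a with a | a
    · exact a.elim0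
    rcases b with b | b
    · exact b.elim0
    simp

lemma isUniversal_graphJoin_inl {a : V} (h : G.IsUniversal a) :
    (graphJoin G H).IsUniversal (.inl a) := by
  rintro (b | b) hb
  · exact graphJoin_adj_inl_inl.2 (h fun h => hb (h ▸ rfl))
  · exact graphJoin_adj_inl_inr

lemma isUniversal_graphJoin_inr_iff {b : W} :
    (graphJoin (⊤ : SimpleGraph V) H).IsUniversal (.inr b) ↔ H.IsUniversal b := by
  constructor
  · intro h c hc
    exact graphJoin_adj_inr_inr.1 (h (w := .inr c) (by simpa using hc))
  · rintro h (c | c) hc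
    · exact graphJoin_adj_inr_inl
    · exact graphJoin_adj_inr_inr.2 (h fun h => hc (h ▸ rfl))

lemma graphJoin_sup_edge (x y : W) :
    graphJoin G H ⊔ edge (.inr x) (.inr y) = graphJoin G (H ⊔ edge x y) := by
  ext a b
  rcases a with a | a <;> rcases b with b | b <;> simp [edge_adj]

/-- Transporting an added edge along an isomorphism. -/
def Iso.supEdge (e : G ≃g H) (x y : V) :
    G ⊔ edge x y ≃g H ⊔ edge (e x) (e y) where
  toEquiv := e.toEquiv
  map_rel_iff' {a b} := by
    simp only [sup_adj, edge_adj]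
    exact or_congr e.map_rel_iff (by simp)

end Join

/-! ### The invariant μ̌ in terms of path covers -/

section MuCheck

variable {V : Type*} [Fintype V] {G : SimpleGraph V}

/-- One vertex of K_l closes the cycle and each of the other l − 1 can join two paths, so the
condition is π(G) ≤ 1 + (l − 1). For l = 0 a Hamiltonian cycle is more than a covering path, whence
`hl`. -/
lemma isHam_graphJoin_iff [Nonempty V] {l : ℕ} (hl : 1 ≤ l) :
    (graphJoin (⊤ : SimpleGraph (Fin l)) G).IsHam ↔ G.pathCover Set.univ ≤ l := by
  classical
  obtain ⟨l, rfl⟩ := Nat.exists_eq_add_of_le' hl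
  have huniv : ∀ i, (graphJoin (⊤ : SimpleGraph (Fin (l + 1))) G).IsUniversal (.inl i) :=
    fun i => isUniversal_graphJoin_inl fun _ h => h
  rw [isHam_iff_pathCover_of_isUniversal (huniv 0)]
  -- `l` is now the predecessor of the original one; `U` holds the vertices of the complete graph
  -- other than `0`.
  let U : Finset (Fin (l + 1) ⊕ V) := Finset.univ.image fun i : Fin l => Sum.inl i.succ
  have hU : ({Sum.inl 0}ᶜ : Set (Fin (l + 1) ⊕ V)) =
      (U : Set (Fin (l + 1) ⊕ V)) ∪
        (Function.Embedding.inr : V ↪ Fin (l + 1) ⊕ V) '' Set.univ := by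
    ext (a | a)
    · cases a using Fin.cases <;> simp [U]
    · simp [U]
  have hcard : U.card = l := by
    rw [Finset.card_image_of_injective, Finset.card_fin]
    intro i j h
    simpa using h
  rw [hU, pathCover_union_of_isUniversal U (by simp [U, huniv]) (by simp [U]) le_rfl,
    pathCover_image (H := G) _ (by simp), hcard, add_comm]

lemma isHam_graphJoin_zero_iff :
    (graphJoin (⊤ : SimpleGraph (Fin 0)) G).IsHam ↔ G.IsHam := isHam_congr (graphJoinZero G)

lemma muCheck_eq_zero_of_isHam (h : G.IsHam) : G.muCheck = 0 :=
  Nat.sInf_eq_zero.2 (.inl (isHam_graphJoin_zero_iff.2 h))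

lemma muCheck_eq_pathCover [Nonempty V] (h : ¬ G.IsHam) : G.muCheck = G.pathCover Set.univ := by
  have hpos : 1 ≤ G.pathCover Set.univ := pathCover_pos Set.univ_nonempty
  refine le_antisymm (Nat.sInf_le ((isHam_graphJoin_iff hpos).2 le_rfl))
    (le_csInf ⟨_, (isHam_graphJoin_iff hpos).2 le_rfl⟩ fun l hl => ?_)
  rcases Nat.eq_zero_or_pos l with rfl | h0
  · exact absurd (isHam_graphJoin_zero_iff.1 hl) h
  · exact (isHam_graphJoin_iff h0).1 hl

lemma muCheck_le_pathCover [Nonempty V] : G.muCheck ≤ G.pathCover Set.univ := by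
  by_cases h : G.IsHam
  · rw [muCheck_eq_zero_of_isHam h]; exact zero_le
  · exact (muCheck_eq_pathCover h).le

/-- A Hamiltonian graph needs one covering path although μ̌ = 0; the indicator makes up the
difference, which is why it enters the formula for t. -/
lemma muCheck_add_hamIndicator [Nonempty V] :
    G.muCheck + G.hamIndicator = G.pathCover Set.univ := by
  by_cases h : G.IsHam
  · have := pathCover_pos (G := G) Set.univ_nonempty
    have := h.pathCover_le_one
    rw [muCheck_eq_zero_of_isHam h, hamIndicator, if_pos h]
    omega
  · rw [muCheck_eq_pathCover h, hamIndicator, if_neg h, add_zero]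

lemma muCheck_congr {W : Type*} [Fintype W] {H : SimpleGraph W} (e : G ≃g H) :
    G.muCheck = H.muCheck := by
  unfold muCheck
  congr 1
  ext l
  exact isHam_congr (graphJoinCongr Iso.refl e)

/-- By associativity of the join, for s > 0 the graph K_l ∗ (K_s ∗ G) is Hamiltonian iff μ̌(G) ≤ l +
s. The subtraction is truncated. -/
lemma muCheck_graphJoin_top [Nonempty V] (s : ℕ) :
    (graphJoin (⊤ : SimpleGraph (Fin s)) G).muCheck = G.muCheck - s := by
  rcases Nat.eq_zero_or_pos s with rfl | hs
  · exact muCheck_congr (graphJoinZero G)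
  have hiff : ∀ l, (graphJoin (⊤ : SimpleGraph (Fin l))
      (graphJoin (⊤ : SimpleGraph (Fin s)) G)).IsHam ↔ G.muCheck ≤ l + s := by
    intro l
    rw [isHam_congr (graphJoinTopAssoc l s G), isHam_graphJoin_iff (by omega)]
    by_cases h : G.IsHam
    · have := h.pathCover_le_one
      rw [muCheck_eq_zero_of_isHam h]
      exact iff_of_true (by omega) (zero_le)
    · rw [muCheck_eq_pathCover h]
  rw [muCheck]
  simp only [hiff]
  refine le_antisymm (Nat.sInf_le (by simp; omega)) (le_csInf ⟨G.muCheck, by simp⟩ fun l hl => ?_)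
  simpa using hl

lemma IsMaximalTraceable.of_graphJoin_top [Nonempty V] {s t : ℕ} (ht : 0 < t)
    (h : IsMaximalTraceable t (graphJoin (⊤ : SimpleGraph (Fin s)) G)) :
    IsMaximalTraceable (t + s) G := by
  obtain ⟨h1, h2⟩ := h
  rw [muCheck_graphJoin_top] at h1
  -- Since `t` is positive, the truncated subtraction in `h1` is exact.
  refine ⟨by omega, fun x y hxy => ?_⟩
  have := h2 (.inr x) (.inr y) (by simpa [compl_adj] using hxy)
  rw [graphJoin_sup_edge, muCheck_graphJoin_top] at this
  omega

lemma IsMaximalTraceable.of_iso {W : Type*} [Fintype W] {H : SimpleGraph W} (e : G ≃g H) {t : ℕ}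
    (h : IsMaximalTraceable t G) : IsMaximalTraceable t H := by
  refine ⟨muCheck_congr e ▸ h.1, fun x y hxy => ?_⟩
  have := h.2 (e.symm x) (e.symm y) (by
    rw [compl_adj] at hxy ⊢
    exact ⟨fun h => hxy.1 (e.symm.injective h), fun h => hxy.2 (e.symm.map_adj_iff.1 h)⟩)
  rwa [muCheck_congr (e.supEdge _ _), e.apply_symm_apply, e.apply_symm_apply] at this

end MuCheck

/-! ### Disjoint unions and maximality -/

section DisjUnion

variable {ι : Type*} {W : ι → Type*} {P : ∀ j, SimpleGraph (W j)}

lemma disjUnion_adj_mk {j : ι} {a b : W j} :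
    (disjUnion P).Adj ⟨j, a⟩ ⟨j, b⟩ ↔ (P j).Adj a b := by
  constructor
  · rintro ⟨k, c, d, h, h1, h2⟩
    cases h1
    cases h2
    exact h
  · exact fun h => ⟨j, a, b, h, rfl, rfl⟩

lemma fst_eq_of_disjUnion_adj {x y : Σ j, W j} (h : (disjUnion P).Adj x y) : x.1 = y.1 := by
  obtain ⟨k, c, d, h, rfl, rfl⟩ := h
  rfl

/-- A disjoint union with a single member. -/
noncomputable def disjUnionUnique (j : ι) (hj : ∀ k, k = j) : P j ≃g disjUnion P where
  toEquiv := Equiv.ofBijective (Sigma.mk j)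
    ⟨sigma_mk_injective, fun ⟨k, a⟩ => by obtain rfl := hj k; exact ⟨a, rfl⟩⟩
  map_rel_iff' {_ _} := disjUnion_adj_mk

lemma disjUnion_sup_edge [DecidableEq ι] (j : ι) (x y : W j) :
    disjUnion P ⊔ edge ⟨j, x⟩ ⟨j, y⟩ = disjUnion (Function.update P j (P j ⊔ edge x y)) := by
  ext ⟨k, a⟩ ⟨l, b⟩
  by_cases hkl : k = l
  · subst hkl
    by_cases hkj : k = j
    · subst hkj
      simp [disjUnion_adj_mk, edge_adj]
    · simp [disjUnion_adj_mk, edge_adj, hkj]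
  · have h1 : ¬ (disjUnion P).Adj ⟨k, a⟩ ⟨l, b⟩ := fun h => hkl (fst_eq_of_disjUnion_adj h)
    have h2 : ¬ (disjUnion (Function.update P j (P j ⊔ edge x y))).Adj ⟨k, a⟩ ⟨l, b⟩ :=
      fun h => hkl (fst_eq_of_disjUnion_adj h)
    simp only [sup_adj, h1, h2, edge_adj, false_or, iff_false]
    rintro ⟨⟨h, h'⟩ | ⟨h, h'⟩, -⟩ <;> exact hkl ((congrArg Sigma.fst h).trans
      (congrArg Sigma.fst h').symm)

variable [Fintype ι] [∀ j, Fintype (W j)]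

lemma pathCover_disjUnion_fiber (j : ι) :
    (disjUnion P).pathCover (Sigma.fst ⁻¹' {j}) = (P j).pathCover Set.univ := by
  rw [← pathCover_image (G := disjUnion P) (H := P j) (Function.Embedding.sigmaMk j)
    (fun a b => disjUnion_adj_mk), Set.image_univ]
  congr 1
  ext ⟨k, a⟩
  constructor
  · rintro rfl
    exact ⟨a, rfl⟩
  · rintro ⟨b, h⟩
    exact (congrArg Sigma.fst h).symm

lemma pathCover_disjUnion (P : ∀ j, SimpleGraph (W j)) :
    (disjUnion P).pathCover Set.univ = ∑ j, (P j).pathCover Set.univ := by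
  rw [pathCover_univ_eq_sum Sigma.fst fun _ _ => fst_eq_of_disjUnion_adj]
  exact Finset.sum_congr rfl fun j _ => pathCover_disjUnion_fiber j

variable [∀ j, Nonempty (W j)]

lemma not_isHam_disjUnion [Nontrivial ι] (P : ∀ j, SimpleGraph (W j)) :
    ¬ (disjUnion P).IsHam := by
  have : Nonempty (Σ j, W j) := ⟨⟨Classical.arbitrary ι, Classical.arbitrary _⟩⟩
  intro h
  have h1 := h.pathCover_le_one
  rw [pathCover_disjUnion] at h1
  have h2 : ∑ _j : ι, 1 ≤ ∑ j, (P j).pathCover Set.univ :=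
    Finset.sum_le_sum fun j _ => pathCover_pos Set.univ_nonempty
  have h3 := Fintype.one_lt_card (α := ι)
  simp only [Finset.sum_const, Finset.card_univ, smul_eq_mul, mul_one] at h2
  omega

lemma muCheck_disjUnion [Nontrivial ι] (P : ∀ j, SimpleGraph (W j)) :
    (disjUnion P).muCheck = ∑ j, (P j).pathCover Set.univ := by
  have : Nonempty (Σ j, W j) := ⟨⟨Classical.arbitrary ι, Classical.arbitrary _⟩⟩
  rw [muCheck_eq_pathCover (not_isHam_disjUnion P), pathCover_disjUnion]

/-- An edge added to a member of a maximal disjoint union lowers its path cover number. -/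
lemma IsMaximalTraceable.pathCover_sup_edge_lt [Nontrivial ι] {t : ℕ}
    (h : IsMaximalTraceable t (disjUnion P)) (j : ι) {x y : W j} (hxy : (P j)ᶜ.Adj x y) :
    (P j ⊔ edge x y).pathCover Set.univ < (P j).pathCover Set.univ := by
  classical
  have h1 := h.1
  have h2 := h.2 ⟨j, x⟩ ⟨j, y⟩ (by
    rw [compl_adj] at hxy ⊢
    exact ⟨fun h => hxy.1 (sigma_mk_injective h), fun h => hxy.2 (disjUnion_adj_mk.1 h)⟩)
  -- Both unions have at least two members, so each μ̌ is a sum of path cover numbers, and only the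
  -- summand at `j` differs.
  rw [disjUnion_sup_edge, muCheck_disjUnion, ← h1, muCheck_disjUnion,
    ← Finset.add_sum_erase _ _ (Finset.mem_univ j), ← Finset.add_sum_erase _ _ (Finset.mem_univ j),
    Function.update_self, Finset.sum_congr rfl fun k hk => by
      rw [Function.update_of_ne (Finset.ne_of_mem_erase hk)]] at h2
  exact lt_of_add_lt_add_right h2

/-- An incomplete member has a missing edge whose addition lowers its path cover number, which is
therefore at least 2; so the member is not Hamiltonian and its μ̌ is that number. A universal vertex
of the member could be joined to another member without lowering μ̌ of the union. -/
lemma isTrim_of_nontrivial [Nontrivial ι] {t : ℕ} (h : IsMaximalTraceable t (disjUnion P))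
    {j : ι} (hconn : (P j).Connected) (hj : P j ≠ ⊤) :
    0 < (P j).muCheck ∧ IsTrim (P j).muCheck (P j) := by
  have : Nonempty (Σ j, W j) := ⟨⟨Classical.arbitrary ι, Classical.arbitrary _⟩⟩
  have hne : ∃ x y, (P j)ᶜ.Adj x y := by
    by_contra! hn
    refine hj (eq_top_iff_forall_isUniversal.2 fun x y hxy => ?_)
    by_contra hadj
    exact hn x y ((compl_adj _ _ _).2 ⟨hxy, hadj⟩)
  have h2 : 2 ≤ (P j).pathCover Set.univ := by
    obtain ⟨x, y, hxy⟩ := hne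
    have h1 := h.pathCover_sup_edge_lt j hxy
    have := pathCover_pos (G := P j ⊔ edge x y) Set.univ_nonempty
    omega
  have hham : ¬ (P j).IsHam := fun hh => by have := hh.pathCover_le_one; omega
  have hmu := muCheck_eq_pathCover hham
  refine ⟨by omega, ⟨rfl, fun x y hxy => ?_⟩, hconn, fun x hx => ?_⟩
  · rw [hmu]
    exact muCheck_le_pathCover.trans_lt (h.pathCover_sup_edge_lt j hxy)
  · obtain ⟨k, hk⟩ := exists_ne j
    obtain ⟨y⟩ : Nonempty (W k) := inferInstance
    have h3 : (disjUnion P).muCheck ≤ (disjUnion P ⊔ edge ⟨j, x⟩ ⟨k, y⟩).muCheck := by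
      have h4 := pathCover_sup_edge_of_forall_adj (G := disjUnion P) Sigma.fst
        (fun _ _ => fst_eq_of_disjUnion_adj) (x := ⟨j, x⟩) (y := ⟨k, y⟩) hk.symm
        (by
          rintro ⟨l, z⟩ rfl hz
          exact disjUnion_adj_mk.2 (hx fun h => hz (h ▸ rfl)))
        (by rwa [pathCover_disjUnion_fiber])
      -- If the enlarged graph were Hamiltonian, `h4` would cover the union by one path, though
      -- member `j` alone needs two.
      by_cases hh : (disjUnion P ⊔ edge ⟨j, x⟩ ⟨k, y⟩).IsHam
      · have h5 := hh.pathCover_le_one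
        exact absurd (h2.trans ((Finset.single_le_sum (f := fun j => (P j).pathCover Set.univ)
          (fun _ _ => Nat.zero_le _) (Finset.mem_univ j)).trans_eq (pathCover_disjUnion P).symm))
          (by omega)
      · rwa [muCheck_eq_pathCover hh, muCheck_eq_pathCover (not_isHam_disjUnion P)]
    have h5 := h.2 ⟨j, x⟩ ⟨k, y⟩ (by
      rw [compl_adj]
      exact ⟨fun h => hk.symm (congrArg Sigma.fst h),
        fun h => hk.symm (fst_eq_of_disjUnion_adj h)⟩)
    rw [← h.1] at h5
    omega

/-- The members of a maximal disjoint union `G_1 ⊔ … ⊔ G_r` without universal vertices, and the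
value of the invariant on it. -/
lemma IsMaximalTraceable.parts [Nonempty ι] {t : ℕ} (ht : 0 < t)
    (h : IsMaximalTraceable t (disjUnion P)) (hconn : ∀ j, (P j).Connected)
    (huniv : ∀ x, ¬ (disjUnion P).IsUniversal x) :
    (∀ j, (P j = ⊤ ∧ (P j).muCheck = 0) ∨
      (0 < (P j).muCheck ∧ IsTrim (P j).muCheck (P j))) ∧
    t = ∑ j, (P j).muCheck + ∑ j, (P j).hamIndicator := by
  -- The edge argument requires a second member. A single member is the whole union up to
  -- isomorphism and inherits everything directly; `ht` excludes its being Hamiltonian.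
  rcases subsingleton_or_nontrivial ι with hι | hι
  · obtain ⟨j⟩ := ‹Nonempty ι›
    have hj : ∀ k, k = j := fun k => Subsingleton.elim k j
    let e := disjUnionUnique (P := P) j hj
    have hmax := h.of_iso e.symm
    have hsum : ∀ f : ι → ℕ, ∑ k, f k = f j := fun f => by
      rw [Finset.sum_eq_single j (fun k _ hk => absurd (hj k) hk) (by simp)]
    have hham : ¬ (P j).IsHam := fun hh => by
      have := muCheck_eq_zero_of_isHam hh
      have := hmax.1
      omega
    refine ⟨fun k => ?_, ?_⟩
    · obtain rfl := hj k
      refine .inr ⟨hmax.1 ▸ ht, ⟨rfl, hmax.1 ▸ hmax.2⟩, hconn k, fun x hx => ?_⟩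
      refine huniv (e x) fun y hy => ?_
      rw [← e.apply_symm_apply y, e.map_adj_iff]
      exact hx fun hxy => hy (by rw [hxy, e.apply_symm_apply])
    · rw [hsum, hsum, hamIndicator, if_neg hham, hmax.1, add_zero]
  · refine ⟨fun j => ?_, ?_⟩
    · by_cases hj : P j = ⊤
      · exact .inl ⟨hj, muCheck_eq_zero_of_isHam (hj ▸ isHam_top)⟩
      · exact .inr (isTrim_of_nontrivial h (hconn j) hj)
    · rw [← h.1, muCheck_disjUnion, ← Finset.sum_add_distrib]
      exact Finset.sum_congr rfl fun j _ => muCheck_add_hamIndicator.symm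

end DisjUnion

lemma Iso.isUniversal_apply_iff {V W : Type*} {G : SimpleGraph V} {H : SimpleGraph W}
    (e : G ≃g H) {x : V} : H.IsUniversal (e x) ↔ G.IsUniversal x := by
  constructor
  · intro h y hy
    exact e.map_adj_iff.1 (h fun h => hy (e.injective h))
  · intro h y hy
    rw [← e.apply_symm_apply y, e.map_adj_iff]
    exact h fun h => hy (by rw [h, e.apply_symm_apply])

/-! ### Rigidity of joins and of disjoint unions -/

section Unique

/-- The isomorphism between two joins restricts to the parts without universal vertices. -/
lemma exists_iso_of_graphJoin_iso {A B V W : Type*} {G : SimpleGraph V} {H : SimpleGraph W}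
    (e : graphJoin (⊤ : SimpleGraph A) G ≃g graphJoin (⊤ : SimpleGraph B) H)
    (hG : ∀ x, ¬ G.IsUniversal x) (hH : ∀ x, ¬ H.IsUniversal x) :
    ∃ f : G ≃g H, ∀ x, e (.inr x) = .inr (f x) := by
  -- Vertices of the complete side are universal in the join and those of the other side are not, so
  -- `e` cannot mix the sides.
  have h1 : ∀ x, ∃ y, e (.inr x) = .inr y := by
    intro x
    cases h : e (.inr x) with
    | inl b =>
      refine absurd ?_ (hG x)
      rw [← isUniversal_graphJoin_inr_iff (V := A), ← e.isUniversal_apply_iff, h]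
      exact isUniversal_graphJoin_inl fun _ h => h
    | inr y => exact ⟨y, rfl⟩
  choose f hf using h1
  refine ⟨⟨Equiv.ofBijective f ⟨fun x y h => ?_, fun y => ?_⟩, fun {x y} => ?_⟩, hf⟩
  · exact Sum.inr_injective (e.injective (by rw [hf, hf, h]))
  · cases h : e.symm (.inr y) with
    | inl a =>
      refine absurd ?_ (hH y)
      rw [← isUniversal_graphJoin_inr_iff (V := B), ← e.symm.isUniversal_apply_iff, h]
      exact isUniversal_graphJoin_inl fun _ h => h
    | inr x => exact ⟨x, Sum.inr_injective (by rw [← hf, ← h, e.apply_symm_apply])⟩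
  · have := e.map_adj_iff (v := .inr x) (w := .inr y)
    rw [hf, hf, graphJoin_adj_inr_inr, graphJoin_adj_inr_inr] at this
    exact this

/-- A homomorphism from a connected graph to a disjoint union lands in a single member. -/
lemma Connected.fst_eq {V ι : Type*} {W : ι → Type*} {G : SimpleGraph V}
    {P : ∀ j, SimpleGraph (W j)} (hG : G.Connected) (f : G →g disjUnion P) (x y : V) :
    (f x).1 = (f y).1 := by
  obtain ⟨p⟩ := hG.preconnected x y
  induction p with
  | nil => rfl
  | cons h _ ih => exact (fst_eq_of_disjUnion_adj (f.map_adj h)).trans ih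

lemma fst_eq_of_disjUnion_iso {ι κ : Type*} {W : ι → Type*} {W' : κ → Type*}
    {P : ∀ j, SimpleGraph (W j)} {Q : ∀ k, SimpleGraph (W' k)} (e : disjUnion P ≃g disjUnion Q)
    (hP : ∀ j, (P j).Connected) {x y : Σ j, W j} (h : x.1 = y.1) : (e x).1 = (e y).1 := by
  obtain ⟨j, x⟩ := x
  obtain ⟨k, y⟩ := y
  obtain rfl : j = k := h
  exact (hP j).fst_eq ⟨fun x => e ⟨j, x⟩, fun h => e.map_adj_iff.2 (disjUnion_adj_mk.2 h)⟩ x y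

/-- An isomorphism between disjoint unions of connected graphs matches up the members. -/
lemma exists_equiv_of_disjUnion_iso {ι κ : Type*} {W : ι → Type*} {W' : κ → Type*}
    {P : ∀ j, SimpleGraph (W j)} {Q : ∀ k, SimpleGraph (W' k)} (e : disjUnion P ≃g disjUnion Q)
    (hP : ∀ j, (P j).Connected) (hQ : ∀ k, (Q k).Connected) :
    ∃ (σ : ι ≃ κ) (f : ∀ j, P j ≃g Q (σ j)), ∀ j x, e ⟨j, x⟩ = ⟨σ j, f j x⟩ := by
  have hneP : ∀ j, Nonempty (W j) := fun j => (hP j).nonempty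
  have hneQ : ∀ k, Nonempty (W' k) := fun k => (hQ k).nonempty
  -- By connectedness the member that `e` hits does not depend on the vertex chosen in `P j`, so
  -- arbitrary vertices serve.
  let σ : ι ≃ κ :=
    { toFun := fun j => (e ⟨j, Classical.arbitrary _⟩).1
      invFun := fun k => (e.symm ⟨k, Classical.arbitrary _⟩).1
      left_inv := fun j => by
        refine (fst_eq_of_disjUnion_iso e.symm hQ
          (x := ⟨(e ⟨j, Classical.arbitrary _⟩).1, Classical.arbitrary _⟩)
          (y := e ⟨j, Classical.arbitrary _⟩) rfl).trans ?_
        exact congrArg Sigma.fst (e.symm_apply_apply _)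
      right_inv := fun k => by
        refine (fst_eq_of_disjUnion_iso e hP
          (x := ⟨(e.symm ⟨k, Classical.arbitrary _⟩).1, Classical.arbitrary _⟩)
          (y := e.symm ⟨k, Classical.arbitrary _⟩) rfl).trans ?_
        exact congrArg Sigma.fst (e.apply_symm_apply _) }
  have h1 : ∀ j x, ∃ y, e ⟨j, x⟩ = ⟨σ j, y⟩ := by
    intro j x
    have h : (e ⟨j, x⟩).1 = σ j := fst_eq_of_disjUnion_iso e hP rfl
    rw [← h]
    exact ⟨_, rfl⟩
  choose f hf using h1
  refine ⟨σ, fun j => ⟨Equiv.ofBijective (f j) ⟨fun x y h => ?_, fun y => ?_⟩,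
    fun {x y} => ?_⟩, hf⟩
  · exact sigma_mk_injective (e.injective (by rw [hf, hf, h]))
  · obtain ⟨⟨k, x⟩, hx⟩ := e.surjective ⟨σ j, y⟩
    obtain rfl : k = j := by
      have h : (⟨σ k, f k x⟩ : Σ k, W' k) = ⟨σ j, y⟩ := (hf k x).symm.trans hx
      have h' := congrArg Sigma.fst h
      exact σ.injective h'
    exact ⟨x, sigma_mk_injective ((hf k x).symm.trans hx)⟩
  · have := e.map_adj_iff (v := ⟨j, x⟩) (w := ⟨j, y⟩)
    rw [hf, hf, disjUnion_adj_mk, disjUnion_adj_mk] at this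
    exact this

end Unique

/-! ### Uniqueness of the decomposition -/

namespace JoinDecomposition

variable {V : Type u} {G : SimpleGraph V}

lemma IsCompleteOrTrim.connected {D : JoinDecomposition.{u, v} G} (hD : D.IsCompleteOrTrim)
    (j : Fin D.r) : (D.part j).Connected := by
  rcases hD j with h | ⟨_, _, h⟩
  · rw [h]; exact connected_top
  · exact h.2.1

/-- A universal vertex of the disjoint union forces a single part. That part is complete, since a
trim one has no universal vertex, and then so is its join with K_s. -/
lemma IsCompleteOrTrim.not_isUniversal {D : JoinDecomposition.{u, v} G} (hD : D.IsCompleteOrTrim)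
    (hG : G ≠ ⊤) (x : Σ j, D.W j) : ¬ (disjUnion D.part).IsUniversal x := by
  intro hx
  obtain ⟨j, x⟩ := x
  have hj : ∀ k, k = j := by
    intro k
    by_contra hk
    exact hk (fst_eq_of_disjUnion_adj (hx (w := ⟨k, Classical.arbitrary _⟩)
      fun h => hk (congrArg Sigma.fst h).symm)).symm
  have htop : D.part j = ⊤ := by
    refine (hD j).resolve_right ?_
    rintro ⟨_, _, h⟩
    refine h.2.2 x fun y hy => disjUnion_adj_mk.1 (hx fun h => hy (sigma_mk_injective h))
  refine hG (eq_top_iff_forall_isUniversal.2 fun v => ?_)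
  obtain ⟨a | ⟨k, y⟩, rfl⟩ := D.iso.surjective v <;> rw [D.iso.isUniversal_apply_iff]
  · exact isUniversal_graphJoin_inl fun _ h => h
  · rw [isUniversal_graphJoin_inr_iff]
    obtain rfl := hj k
    rintro ⟨l, z⟩ hz
    obtain rfl := hj l
    rw [disjUnion_adj_mk, htop]
    exact fun h => hz (h ▸ rfl)

lemma s_eq_ncard (D : JoinDecomposition.{u, v} G)
    (hD : ∀ x, ¬ (disjUnion D.part).IsUniversal x) : D.s = G.universalVerts.ncard := by
  have h : G.universalVerts = Set.range fun i => D.iso (.inl i) := by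
    ext v
    constructor
    · intro hv
      obtain ⟨a | y, rfl⟩ := D.iso.surjective v
      · exact ⟨a, rfl⟩
      · exact absurd (isUniversal_graphJoin_inr_iff.1 (D.iso.isUniversal_apply_iff.1 hv)) (hD y)
    · rintro ⟨i, rfl⟩
      exact D.iso.isUniversal_apply_iff.2 (isUniversal_graphJoin_inl fun _ h => h)
  rw [h]
  exact (Nat.card_fin _).symm.trans
    (Set.ncard_range_of_injective (D.iso.injective.comp Sum.inl_injective)).symm

lemma IsCompleteOrTrim.same {D : JoinDecomposition.{u, u} G} {D' : JoinDecomposition.{u, v} G}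
    (hD : D.IsCompleteOrTrim) (hD' : D'.IsCompleteOrTrim) (hG : G ≠ ⊤) : D.Same D' := by
  have hu := hD.not_isUniversal hG
  have hu' := hD'.not_isUniversal hG
  refine ⟨(D.s_eq_ncard hu).trans (D'.s_eq_ncard hu').symm, ?_⟩
  obtain ⟨e, he⟩ := exists_iso_of_graphJoin_iso (D.iso.trans D'.iso.symm) hu hu'
  obtain ⟨σ, f, hf⟩ := exists_equiv_of_disjUnion_iso e hD.connected hD'.connected
  refine ⟨σ, f, fun j x => ?_⟩
  rw [← hf, ← he]
  exact D'.iso.apply_symm_apply _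

end JoinDecomposition

/-! ### Existence: universal vertices and components of the rest -/

section Exists

variable {V : Type u}

/-- A graph is the disjoint union of its connected components, indexed along any bijection. -/
noncomputable def disjUnionComponentsIso {W ι : Type*} (H : SimpleGraph W)
    (e : ι ≃ H.ConnectedComponent) : disjUnion (fun j => (e j).toSimpleGraph) ≃g H where
  toEquiv := Equiv.ofBijective (fun x => x.2.1) (by
    constructor
    · rintro ⟨j, x, hx⟩ ⟨k, y, hy⟩ (rfl : x = y)
      obtain rfl : j = k := e.injective (hx.symm.trans hy)
      rfl
    · intro x
      exact ⟨⟨e.symm (H.connectedComponentMk x), x, by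
        rw [e.apply_symm_apply]; exact ConnectedComponent.connectedComponentMk_mem⟩, rfl⟩)
  map_rel_iff' {a b} := by
    obtain ⟨j, x, hx⟩ := a
    obtain ⟨k, y, hy⟩ := b
    constructor
    · intro (h : H.Adj x y)
      obtain rfl : j = k :=
        e.injective (hx.symm.trans ((ConnectedComponent.sound h.reachable).trans hy))
      exact disjUnion_adj_mk.2 h
    · intro h
      obtain rfl : j = k := fst_eq_of_disjUnion_adj h
      exact disjUnion_adj_mk.1 h

open Classical in
/-- A graph is the join of its universal vertices and the graph on its other vertices. -/
noncomputable def graphJoinUniversalIso [Finite V] (G : SimpleGraph V) :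
    graphJoin (⊤ : SimpleGraph (Fin G.universalVerts.ncard)) (G.induce G.universalVertsᶜ) ≃g G where
  toEquiv := ((Finite.equivFin G.universalVerts).symm.sumCongr (Equiv.refl _)).trans
    (Equiv.Set.sumCompl G.universalVerts)
  map_rel_iff' {a b} := by
    rcases a with a | a <;> rcases b with b | b
    · have ha := ((Finite.equivFin G.universalVerts).symm a).2
      simp only [graphJoin_adj_inl_inl, top_adj]
      refine ⟨fun h hab => h.ne (by rw [hab]), fun h => ha fun hab => h ?_⟩
      exact (Finite.equivFin G.universalVerts).symm.injective (Subtype.ext hab)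
    · refine iff_of_true ?_ graphJoin_adj_inl_inr
      exact ((Finite.equivFin G.universalVerts).symm a).2
        fun h => b.2 (Set.mem_of_eq_of_mem h.symm
          ((Finite.equivFin G.universalVerts).symm a).2)
    · refine iff_of_true ?_ graphJoin_adj_inr_inl
      refine (((Finite.equivFin G.universalVerts).symm b).2
        fun h => a.2 (Set.mem_of_eq_of_mem h.symm
          ((Finite.equivFin G.universalVerts).symm b).2)).symm
    · simp

/-- The decomposition of `K_s ∗ H` given by the connected components of `H`. -/
noncomputable def componentDecomposition {U : Type u} [Finite U] {G : SimpleGraph V} {s : ℕ}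
    (H : SimpleGraph U) (i : graphJoin (⊤ : SimpleGraph (Fin s)) H ≃g G) :
    JoinDecomposition.{u, u} G where
  s := s
  r := Nat.card H.ConnectedComponent
  W := fun j => ↥((Finite.equivFin H.ConnectedComponent).symm j)
  fintypeW := fun _ => Fintype.ofFinite _
  nonemptyW := fun _ => (ConnectedComponent.connected_toSimpleGraph _).nonempty
  part := fun j => ((Finite.equivFin H.ConnectedComponent).symm j).toSimpleGraph
  iso := (graphJoinCongr Iso.refl
    (disjUnionComponentsIso H (Finite.equivFin H.ConnectedComponent).symm)).trans i

/-- Every graph has a decomposition with connected parts in which `K_s` consists of the universal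
vertices. -/
lemma exists_joinDecomposition [Finite V] (G : SimpleGraph V) :
    ∃ D : JoinDecomposition.{u, u} G, D.s = G.universalVerts.ncard ∧
      (∀ j, (D.part j).Connected) ∧ ∀ x, ¬ (disjUnion D.part).IsUniversal x := by
  let D := componentDecomposition _ (graphJoinUniversalIso G)
  refine ⟨D, rfl, fun j => ConnectedComponent.connected_toSimpleGraph _, fun x hx => ?_⟩
  have h := (isUniversal_graphJoin_inr_iff (V := Fin D.s)).2 hx
  rw [← D.iso.isUniversal_apply_iff] at h
  -- The isomorphism sends `x` to a vertex of `G` outside `universalVerts`, whereas `h` says that it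
  -- is universal.
  exact (disjUnionComponentsIso _ _ x).2 h

end Exists

end SimpleGraph

theorem mainTheorem1 {V : Type u} [Fintype V] [Nonempty V] (G : SimpleGraph V) (t : ℕ)
    (ht : 0 < t) (hG : SimpleGraph.IsMaximalTraceable t G) :
    ∃ D : SimpleGraph.JoinDecomposition.{u, u} G,
      -- existence of the decomposition, with `s` the number of universal vertices
      D.s = G.universalVerts.ncard ∧
      D.IsCompleteOrTrim ∧
      -- the formula for `t`, where `t_j = 0` if `G_j` is complete and `G_j ∈ 𝓝_{t_j}` otherwise
      (∃ τ : Fin D.r → ℕ,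
        (∀ j, τ j = (D.part j).muCheck) ∧
        (∀ j, (D.part j = ⊤ ∧ τ j = 0) ∨
          (0 < τ j ∧ SimpleGraph.IsTrim (τ j) (D.part j))) ∧
        (t : ℤ) = ∑ j, (τ j : ℤ) + ∑ j, ((D.part j).hamIndicator : ℤ) - (D.s : ℤ)) ∧
      -- uniqueness
      ∀ D' : SimpleGraph.JoinDecomposition.{u, v} G, D'.IsCompleteOrTrim → D.Same D' := by
  -- A complete graph has μ̌ = 0, against `ht`; hence some vertex is not universal and there is at
  -- least one part.
  have htop : G ≠ ⊤ := by
    rintro rfl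
    have := hG.1
    rw [SimpleGraph.muCheck_eq_zero_of_isHam SimpleGraph.isHam_top] at this
    omega
  obtain ⟨D, hs, hconn, huniv⟩ := SimpleGraph.exists_joinDecomposition G
  obtain ⟨x⟩ : Nonempty (Σ j, D.W j) := by
    by_contra hempty
    refine htop (SimpleGraph.eq_top_iff_forall_isUniversal.2 fun v => ?_)
    obtain ⟨a | x, rfl⟩ := D.iso.surjective v
    · exact D.iso.isUniversal_apply_iff.2 (SimpleGraph.isUniversal_graphJoin_inl fun _ h => h)
    · exact absurd ⟨x⟩ hempty
  have : Nonempty (Σ j, D.W j) := ⟨x⟩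
  have : Nonempty (Fin D.r) := ⟨x.1⟩
  have hmax := (hG.of_iso D.iso.symm).of_graphJoin_top ht
  obtain ⟨hparts, hsum⟩ := hmax.parts (by omega) hconn huniv
  have hD : D.IsCompleteOrTrim := fun j => (hparts j).imp And.left fun h => ⟨_, h⟩
  refine ⟨D, hs, hD, ⟨fun j => (D.part j).muCheck, fun _ => rfl, hparts, ?_⟩,
    fun D' hD' => hD.same hD' htop⟩
  -- `hsum` has t + s on the left, in ℕ; the formula with −s is read in ℤ, where nothing is
  -- truncated.
  rw [eq_sub_iff_add_eq]
  exact_mod_cast hsum
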